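/- There is an absolute constant $C_1>0$ such that the following holds. Let $n,p\ge 1$ be integers, $\sigma>0$, and let $\mathbb X\in\mathbb R^{n\times p}$ satisfy $\max_{j}\|\mathbb X e_j\|_n\le 1$, where $e_1,\dots,e_p$ is the canonical basis of $\mathbb R^p$ and $\|u\|_n^2=\frac1n\sum_{i=1}^n u_i^2$. For $\beta\in\mathbb R^p$ let $\mathbb P_{\beta}$ be the law of $y=\mathbb X\beta+\xi$ with $\xi\sim\mathcal N(0,\sigma^2 I_{n\times n})$, and put $B_0(s)=\{\beta\in\mathbb R^p:\ \beta \text{ has at most } s \text{ nonzero components}\}$. Put $$\theta(s,c_0)=\min\Big\{\frac{\|\mathbb X\delta\|_n}{|\delta|_2}:\ \delta\in\mathbb R^p,\ \delta\neq 0,\ |\delta|_1\le(1+c_0)\sqrt s\,|\delta|_2\Big\}.$$ Let $s_*\ge 2$ be an integer with $s_*\le p/(2e)$ such that $\theta_*:=\theta(2s_*,7)>0$, and set $$C_0=\frac{7(4+\sqrt2)}{2\theta_*},\qquad w(b)=C_0\sigma\sqrt{\frac{b\log(2ep/b)}{n}} .$$ For $k=1,\dots,2s_*$ let $\hat\beta_k=\hat\beta_k(y)$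 be a Lasso estimator with tuning parameter $\lambda(k)=2(4+\sqrt2)\sigma\sqrt{\log(2ep/k)/n}$, that is, any minimizer over $\beta\in\mathbb R^p$ of $\|\mathbb X\beta-y\|_n^2+2\lambda(k)|\beta|_1$. Let $b_j=2^{j-1}$ for $j\ge1$ and $M=\max\{m\ge 1: b_m\le s_*\}$. Define $$\hat m=\min\big\{m\in\{2,\dots,M\}:\ \|\mathbb X(\hat\beta_{b_k}-\hat\beta_{b_{k-1}})\|_n\le 2w(b_k)\ \text{ for all } k\in\{m,\dots,M\}\big\},$$ with $\hat m=M$ if this set is empty, and put $\hat s=b_{\hat m-1}$ and $\tilde\beta=\hat\beta_{2\hat s}$. Then for all integers $1\le s\le s_*$, $$\sup_{\beta^*\in B_0(s)}\mathbb P_{\beta^*}\Big(\|\mathbb X(\tilde\beta-\beta^*)\|_n\ge C_1C_0\sigma\sqrt{\frac{s\log(2ep/s)}{n}}\Big)\le\big(2(\log_2 p)^2+1\big)\Big(\frac{2s}{p}\Big)^{2s}$$ and $$\inf_{\beta^*\in B_0(s)}\mathbb P_{\beta^*}(\hat s\le s)\ge 1-2(\log_2 p)^2\Big(\frac{2s}{p}\Big)^{2s}.$$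 -/

import Mathlib

open MeasureTheory ProbabilityTheory Matrix

noncomputable section

namespace LassoLepski

/-- The empirical norm `‖u‖_n = (n⁻¹ ∑ uᵢ²)^{1/2}` on `ℝⁿ`. -/
def empNorm {n : ℕ} (u : Fin n → ℝ) : ℝ :=
  Real.sqrt ((1 / (n : ℝ)) * ∑ i, u i ^ 2)

/-- The `ℓ₁` norm. -/
def l1Norm {p : ℕ} (b : Fin p → ℝ) : ℝ := ∑ j, |b j|

/-- The `ℓ₂` norm. -/
def l2Norm {p : ℕ} (b : Fin p → ℝ) : ℝ := Real.sqrt (∑ j, b j ^ 2)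

/-- The class `B₀(s)` of vectors with at most `s` nonzero components. -/
def sparseBall (p s : ℕ) : Set (Fin p → ℝ) :=
  {b | {j | b j ≠ 0}.ncard ≤ s}

/-- The cone `{δ : |δ|₁ ≤ (1 + c₀) √s |δ|₂}`. -/
def sreCone (p s : ℕ) (c₀ : ℝ) : Set (Fin p → ℝ) :=
  {δ | l1Norm δ ≤ (1 + c₀) * Real.sqrt s * l2Norm δ}

/-- The strong restricted eigenvalue constant `θ(s, c₀)` of the design `X`: the minimum of
`‖Xδ‖_n / |δ|₂` over the nonzero `δ` in the cone. -/
def sreConst {n p : ℕ} (X : Matrix (Fin n) (Fin p) ℝ) (s : ℕ) (c₀ : ℝ) : ℝ :=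
  sInf {r | ∃ δ ∈ sreCone p s c₀, δ ≠ 0 ∧ r = empNorm (X *ᵥ δ) / l2Norm δ}

/-- `b` is a Lasso estimator with tuning parameter `lam` for the observation `y`: a minimizer of
`‖Xb - y‖_n² + 2 lam |b|₁` over `ℝᵖ`. -/
def IsLasso {n p : ℕ} (X : Matrix (Fin n) (Fin p) ℝ) (lam : ℝ) (y : Fin n → ℝ)
    (b : Fin p → ℝ) : Prop :=
  IsMinOn (fun v : Fin p → ℝ => empNorm (X *ᵥ v - y) ^ 2 + 2 * lam * l1Norm v) Set.univ b

/-- The tuning parameter `λ(s) = 2 (4 + √2) σ √(log(2ep/s)/n)`. -/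
def tuning (n p : ℕ) (σ : ℝ) (s : ℕ) : ℝ :=
  2 * (4 + Real.sqrt 2) * σ * Real.sqrt (Real.log (2 * Real.exp 1 * p / s) / n)

/-- The law of `y = X β + ξ` with `ξ ∼ N(0, σ² I)`. -/
def modelLaw {n p : ℕ} (X : Matrix (Fin n) (Fin p) ℝ) (σ : ℝ) (β : Fin p → ℝ) :
    Measure (Fin n → ℝ) :=
  (Measure.pi fun _ : Fin n => gaussianReal 0 (Real.toNNReal (σ ^ 2))).map
    (fun ξ => X *ᵥ β + ξ)

/-- The constant `C₀ = 7 (4 + √2) / (2 θ_*)` with `θ_* = θ(2 s_*, 7)`. -/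
def constC₀ {n p : ℕ} (X : Matrix (Fin n) (Fin p) ℝ) (sStar : ℕ) : ℝ :=
  7 * (4 + Real.sqrt 2) / (2 * sreConst X (2 * sStar) 7)

/-- The threshold `w(b) = C₀ σ √(b log(2ep/b)/n)`. -/
def threshold {n p : ℕ} (X : Matrix (Fin n) (Fin p) ℝ) (σ : ℝ) (sStar b : ℕ) : ℝ :=
  constC₀ X sStar * σ * Real.sqrt (b * Real.log (2 * Real.exp 1 * p / b) / n)

/-- The prediction distance `d(β, β') = ‖X(β - β')‖_n`. -/
def predDist {n p : ℕ} (X : Matrix (Fin n) (Fin p) ℝ) (b b' : Fin p → ℝ) : ℝ :=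
  empNorm (X *ᵥ (b - b'))

/-- The dyadic grid `b_j = 2^{j-1}`, used for `j ≥ 1`. -/
def grid (j : ℕ) : ℕ := 2 ^ (j - 1)

/-- `M = max {m ≥ 1 : b_m ≤ s_*}`. -/
def gridMax (sStar : ℕ) : ℕ := sSup {m : ℕ | 1 ≤ m ∧ grid m ≤ sStar}

/-- The indices `m ∈ {2, …, M}` with `d(β̂_{b_k}, β̂_{b_{k-1}}) ≤ 2 w(b_k)` for all
`k ∈ {m, …, M}`. Here `est k` is the estimator with index `k`, at the given observation. -/
def admissible {n p : ℕ} (X : Matrix (Fin n) (Fin p) ℝ) (σ : ℝ) (sStar : ℕ)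
    (est : ℕ → Fin p → ℝ) : Set ℕ :=
  {m | 2 ≤ m ∧ m ≤ gridMax sStar ∧ ∀ k, m ≤ k → k ≤ gridMax sStar →
    predDist X (est (grid k)) (est (grid (k - 1))) ≤ 2 * threshold X σ sStar (grid k)}

open Classical in
/-- The selected index `m̂`: the least admissible index, and `M` if there is none. -/
def mHat {n p : ℕ} (X : Matrix (Fin n) (Fin p) ℝ) (σ : ℝ) (sStar : ℕ)
    (est : ℕ → Fin p → ℝ) : ℕ :=
  if (admissible X σ sStar est).Nonempty then sInf (admissible X σ sStar est)
  else gridMax sStar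

/-- The estimator `ŝ = b_{m̂ - 1}` of the sparsity. -/
def sHat {n p : ℕ} (X : Matrix (Fin n) (Fin p) ℝ) (σ : ℝ) (sStar : ℕ)
    (est : ℕ → Fin p → ℝ) : ℕ :=
  grid (mHat X σ sStar est - 1)

/-- The aggregated estimator `β̃ = β̂_{2 ŝ}`. -/
def betaTilde {n p : ℕ} (X : Matrix (Fin n) (Fin p) ℝ) (σ : ℝ) (sStar : ℕ)
    (est : ℕ → Fin p → ℝ) : Fin p → ℝ :=
  est (2 * sHat X σ sStar est)

end LassoLepski

end

/-!
The noise enters only through one event for each dyadic level `B`. It is called large at level `B`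
(`largeNoise`) if some `B` columns of `X` span a subspace on which the projection of `ξ` has squared
norm at least `8 σ² B log (2ep/B)`. Such a projection has a chi-square law with at most `B` degrees
of freedom (`noise_proj_tail`), and a union bound over the `B`-subsets of the columns gives the
event a probability of at most `exp (-2 B log (2ep/B))` (`largeNoise_prob_le`), which is at most
`(2s/p)^(2s)` when `s ≤ B`. At most `log₂ p` levels are used.

Suppose that the noise is not large at level `B`, and maximize the captured squared norm minus
`8 σ² log (2ep/B)` per column over the sets of at most `B` columns. The maximizer has fewer than `B`
elements, so no column can be added with profit: `ξ` is the sum of a vector of squared norm at most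
`8 σ² B log (2ep/B)` and of a residual whose correlation with every column is small
(`exists_short_add_nearly_orthogonal`). Hence, for every `δ`, the scalar product of `ξ` with `X δ`
is controlled by `√B ‖X δ‖_n + |δ|₁`. With the basic inequality for the Lasso
(`IsLasso.basic_inequality`) and the restricted eigenvalue, it follows that every `B`-sparse `β` is
within `w(B)` of the estimators with index `b` such that `b ≤ B ≤ 2b` (`predDist_le_threshold`). The
constants leave room for the index `b = B / 2`, whose tuning parameter is slightly larger. This
matters because `s` may lie strictly between two consecutive grid points: consecutive estimators are
then compared at the larger of the two, where `β` is still sparse enough.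

The rest is deterministic. If the noise is not large at any dyadic level in `(s, 2 s_*]`, then
consecutive estimators on the grid are within `2 w(b_k)` of each other whenever `b_k > s`, so that
`ŝ ≤ s` (`sHat_le`). The estimator `β̃` has the index `2 ŝ = b_m̂ ≤ 2s`. If `b_m̂ > s`, then `β` is
within `w(b_m̂)` of it. Otherwise the tests passed by `m̂` chain it to the last grid point up to
`s`, at a cost of a geometric sum of thresholds (`predDist_betaTilde_le`). The estimators need not be
measurable; the events they define contain, or are contained in, measurable noise events.
-/

noncomputable section

namespace LassoLepski

/-! ### Gaussian chi-square tails -/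

/-- The orthogonal projection of a standard Gaussian vector onto a subspace is standard Gaussian
there. -/
lemma map_orthogonalProjectionOnto_stdGaussian {E : Type*} [NormedAddCommGroup E]
    [InnerProductSpace ℝ E] [FiniteDimensional ℝ E] [MeasurableSpace E] [BorelSpace E]
    (U : Submodule ℝ E) :
    (stdGaussian E).map U.orthogonalProjectionOnto = stdGaussian U := by
  apply Measure.ext_of_charFunDual
  ext L
  rw [charFunDual_map, charFunDual_stdGaussian, charFunDual_stdGaussian]
  have h : ‖L.comp U.orthogonalProjectionOnto‖ = ‖L‖ := by
    apply le_antisymm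
    · refine (L.opNorm_comp_le _).trans ?_
      exact mul_le_of_le_one_right (norm_nonneg _) U.orthogonalProjectionOnto_norm_le
    · refine L.opNorm_le_bound (norm_nonneg _) fun x => ?_
      simpa using (L.comp U.orthogonalProjectionOnto).le_opNorm (x : E)
  rw [h]

lemma integral_exp_sq_gaussianReal :
    ∫ x, Real.exp (3 / 8 * x ^ 2) ∂(gaussianReal 0 1) = 2 := by
  rw [integral_gaussianReal_eq_integral_smul one_ne_zero]
  have h : ∀ x : ℝ, gaussianPDFReal 0 1 x • Real.exp (3 / 8 * x ^ 2)
      = (√(2 * Real.pi))⁻¹ * Real.exp (-(1 / 8) * x ^ 2) := by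
    intro x
    simp only [gaussianPDFReal, NNReal.coe_one, mul_one, sub_zero, smul_eq_mul]
    rw [mul_assoc, ← Real.exp_add]
    congr 2
    ring
  simp_rw [h]
  rw [integral_const_mul, integral_gaussian,
    show Real.pi / (1 / 8) = 2 ^ 2 * (2 * Real.pi) by ring,
    Real.sqrt_mul (show (0 : ℝ) ≤ 2 ^ 2 by norm_num) (2 * Real.pi), Real.sqrt_sq (by norm_num)]
  have : √(2 * Real.pi) ≠ 0 := (Real.sqrt_pos.2 (by positivity)).ne'
  field_simp

/-- Chernoff's bound at the exponent `3/8`, where the moment generating function of a squared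
standard Gaussian equals `2`. -/
lemma stdGaussian_norm_sq_ge_le {E : Type*} [NormedAddCommGroup E]
    [InnerProductSpace ℝ E] [FiniteDimensional ℝ E] [MeasurableSpace E] [BorelSpace E] (t : ℝ) :
    (stdGaussian E).real {x | t ≤ ‖x‖ ^ 2} ≤
      2 ^ Module.finrank ℝ E * Real.exp (-(3 / 8) * t) := by
  set d := Module.finrank ℝ E
  let μ : Measure (Fin d → ℝ) := Measure.pi fun _ => gaussianReal 0 1
  have hnorm : ∀ x : Fin d → ℝ, ‖∑ i, x i • stdOrthonormalBasis ℝ E i‖ ^ 2 = ∑ i, x i ^ 2 := by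
    intro x
    have := (stdOrthonormalBasis ℝ E).sum_sq_norm_inner_right
      (∑ i, x i • stdOrthonormalBasis ℝ E i)
    rw [← this]
    refine Finset.sum_congr rfl fun i _ => ?_
    simp [inner_sum, inner_smul_right, orthonormal_iff_ite.1 (stdOrthonormalBasis ℝ E).orthonormal]
  have hint : ∫ x, Real.exp (3 / 8 * ∑ i, x i ^ 2) ∂μ = 2 ^ d := by
    simp_rw [Finset.mul_sum, Real.exp_sum]
    rw [integral_fintype_prod_eq_prod (fun (_ : Fin d) (x : ℝ) => Real.exp (3 / 8 * x ^ 2))]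
    simp [integral_exp_sq_gaussianReal]
  have hI : Integrable (fun x => Real.exp (3 / 8 * ∑ i, x i ^ 2)) μ := by
    by_contra h
    rw [integral_undef h] at hint
    exact (pow_ne_zero d two_ne_zero) hint.symm
  have hmap : (stdGaussian E).real {x | t ≤ ‖x‖ ^ 2} = μ.real {x | t ≤ ∑ i, x i ^ 2} := by
    rw [stdGaussian, map_measureReal_apply (by fun_prop)
      (measurableSet_le measurable_const (by fun_prop))]
    congr 1
    ext x
    change t ≤ ‖∑ i, x i • stdOrthonormalBasis ℝ E i‖ ^ 2 ↔ t ≤ ∑ i, x i ^ 2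
    rw [hnorm]
  rw [hmap]
  refine (measure_ge_le_exp_mul_mgf t (by norm_num : (0 : ℝ) ≤ 3 / 8) hI).trans_eq ?_
  rw [mgf, hint, mul_comm]

/-- The law of the noise is a dilation of the standard Gaussian law. -/
lemma pi_gaussianReal_eq_map_stdGaussian {n : ℕ} {σ : ℝ} :
    (Measure.pi fun _ : Fin n => gaussianReal 0 (Real.toNNReal (σ ^ 2))) =
      (stdGaussian (EuclideanSpace ℝ (Fin n))).map (fun z i => σ * z i) := by
  rw [← map_pi_eq_stdGaussian, Measure.map_map (by fun_prop) (by fun_prop)]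
  have h : gaussianReal 0 (Real.toNNReal (σ ^ 2)) = (gaussianReal 0 1).map (σ * ·) := by
    rw [gaussianReal_map_const_mul]
    congr 1
    · simp
    · ext
      simp [sq_nonneg]
  have : ∀ _ : Fin n, SigmaFinite ((gaussianReal 0 1).map (σ * ·)) := fun _ => by
    rw [← h]; infer_instance
  rw [h, ← Measure.pi_map_pi (fun _ => by fun_prop)]
  rfl

/-- A projection of the noise onto a subspace of dimension at most `d` has a chi-square tail. -/
lemma noise_proj_tail {n : ℕ} {σ : ℝ} (hσ : 0 < σ)
    (U : Submodule ℝ (EuclideanSpace ℝ (Fin n))) {d : ℕ} (hd : Module.finrank ℝ U ≤ d) (t : ℝ) :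
    (Measure.pi fun _ : Fin n => gaussianReal 0 (Real.toNNReal (σ ^ 2))).real
      {ξ | σ ^ 2 * t ≤ ‖U.starProjection (WithLp.toLp 2 ξ)‖ ^ 2} ≤
      2 ^ d * Real.exp (-(3 / 8) * t) := by
  rw [pi_gaussianReal_eq_map_stdGaussian, map_measureReal_apply (by fun_prop)
      (measurableSet_le measurable_const (by fun_prop))]
  have hset : ((fun (z : EuclideanSpace ℝ (Fin n)) i => σ * z i) ⁻¹'
      {ξ | σ ^ 2 * t ≤ ‖U.starProjection (WithLp.toLp 2 ξ)‖ ^ 2}) =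
      U.orthogonalProjectionOnto ⁻¹' {x | t ≤ ‖x‖ ^ 2} := by
    ext z
    have hz : WithLp.toLp 2 (fun i => σ * z i) = σ • z := by
      ext i; simp
    change σ ^ 2 * t ≤ ‖U.starProjection (WithLp.toLp 2 (fun i => σ * z i))‖ ^ 2 ↔
      t ≤ ‖U.orthogonalProjectionOnto z‖ ^ 2
    rw [hz, map_smul, norm_smul, mul_pow, Real.norm_eq_abs, sq_abs, Submodule.starProjection_apply,
      ← Submodule.coe_norm]
    exact mul_le_mul_iff_right₀ (by positivity)
  rw [hset, ← map_measureReal_apply (by fun_prop)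
      (measurableSet_le measurable_const (by fun_prop)),
    map_orthogonalProjectionOnto_stdGaussian]
  refine (stdGaussian_norm_sq_ge_le t).trans ?_
  gcongr
  norm_num

/-! ### Splitting a vector along an optimal set of columns -/

/-- The span of the vectors `x j`, `j ∈ J`. -/
def familySpan {E ι : Type*} [NormedAddCommGroup E] [InnerProductSpace ℝ E] (x : ι → E)
    (J : Finset ι) : Submodule ℝ E :=
  Submodule.span ℝ (x '' J)

instance {E ι : Type*} [NormedAddCommGroup E] [InnerProductSpace ℝ E] [FiniteDimensional ℝ E]
    (x : ι → E) (J : Finset ι) : (familySpan x J).HasOrthogonalProjection :=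
  inferInstance

lemma familySpan_mono {E ι : Type*} [NormedAddCommGroup E] [InnerProductSpace ℝ E] (x : ι → E)
    {J J' : Finset ι} (h : J ⊆ J') : familySpan x J ≤ familySpan x J' :=
  Submodule.span_mono (Set.image_mono (by exact_mod_cast h))

lemma finrank_familySpan_le {E ι : Type*} [NormedAddCommGroup E] [InnerProductSpace ℝ E]
    (x : ι → E) (J : Finset ι) : Module.finrank ℝ (familySpan x J) ≤ J.card := by
  classical
  have h := finrank_span_finset_le_card (R := ℝ) (J.image x)
  rw [Finset.coe_image] at h
  exact h.trans Finset.card_image_le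

/-- Enlarging `U` to a subspace `V` containing `v` raises the squared norm of the projection of `ξ`
at least by the squared component of the residual along `v`. -/
lemma sq_inner_residual_le {E : Type*} [NormedAddCommGroup E] [InnerProductSpace ℝ E]
    [FiniteDimensional ℝ E] {U V : Submodule ℝ E} (hUV : U ≤ V) {v : E} (hv : v ∈ V) (ξ : E) :
    (inner ℝ (ξ - U.starProjection ξ) v) ^ 2 ≤
      (‖V.starProjection ξ‖ ^ 2 - ‖U.starProjection ξ‖ ^ 2) * ‖v‖ ^ 2 := by
  have hdiff : V.starProjection ξ - U.starProjection ξ ∈ V :=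
    V.sub_mem (V.starProjection_apply_mem ξ) (hUV (U.starProjection_apply_mem ξ))
  have hinner : inner ℝ (ξ - U.starProjection ξ) v =
      inner ℝ (V.starProjection ξ - U.starProjection ξ) v := by
    have h := V.starProjection_inner_eq_zero ξ v hv
    rw [show ξ - U.starProjection ξ =
      (ξ - V.starProjection ξ) + (V.starProjection ξ - U.starProjection ξ) by abel,
      inner_add_left, h, zero_add]
  have hnorm : ‖V.starProjection ξ - U.starProjection ξ‖ ^ 2 =
      ‖V.starProjection ξ‖ ^ 2 - ‖U.starProjection ξ‖ ^ 2 := by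
    have h1 := U.starProjection_inner_eq_zero ξ _ (U.starProjection_apply_mem ξ)
    have h2 := V.starProjection_inner_eq_zero ξ _ (hUV (U.starProjection_apply_mem ξ))
    rw [inner_sub_left, sub_eq_zero] at h1 h2
    rw [norm_sub_sq_real, ← h2, h1, real_inner_self_eq_norm_sq]
    ring
  rw [hinner, ← hnorm, ← mul_pow, ← sq_abs]
  exact pow_le_pow_left₀ (abs_nonneg _) (abs_real_inner_le_norm _ _) 2

/-- If every `B` of the vectors `x j` capture less than `μ B` of the squared norm of `ξ`, then `ξ`
is the sum of a short vector and of one that is nearly orthogonal to all `x j`. -/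
lemma exists_short_add_nearly_orthogonal {E ι : Type*} [NormedAddCommGroup E]
    [InnerProductSpace ℝ E] [FiniteDimensional ℝ E] [Fintype ι] (x : ι → E) (ξ : E) {μ : ℝ}
    {B : ℕ} (hB : B ≤ Fintype.card ι)
    (h : ∀ J : Finset ι, J.card = B → ‖(familySpan x J).starProjection ξ‖ ^ 2 < μ * B) :
    ∃ P Q : E, ξ = P + Q ∧ ‖P‖ ^ 2 ≤ μ * B ∧ ∀ j, (inner ℝ Q (x j)) ^ 2 ≤ μ * ‖x j‖ ^ 2 := by
  classical
  -- The optimal set maximizes the captured energy, each vector being charged the price `μ`.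
  obtain ⟨J, hJ, hmax⟩ := Finset.exists_max_image
    (Finset.univ.filter fun J : Finset ι => J.card ≤ B)
    (fun J => ‖(familySpan x J).starProjection ξ‖ ^ 2 - μ * J.card) ⟨∅, by simp⟩
  simp only [Finset.mem_filter, Finset.mem_univ, true_and] at hJ hmax
  have hnonneg : 0 ≤ ‖(familySpan x J).starProjection ξ‖ ^ 2 - μ * J.card := by
    refine le_trans ?_ (hmax ∅ (by simp))
    simp
  have hlt : J.card < B := by
    refine lt_of_le_of_ne hJ fun hc => ?_
    have := h J hc
    rw [hc] at hnonneg
    linarith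
  refine ⟨(familySpan x J).starProjection ξ, ξ - (familySpan x J).starProjection ξ, by abel, ?_,
    fun j => ?_⟩
  · obtain ⟨J', hJJ', hcard⟩ := Finset.exists_superset_card_eq hJ hB
    refine le_trans ?_ (h J' hcard).le
    have hc : (familySpan x J).starProjection ξ =
        (familySpan x J).starProjection ((familySpan x J').starProjection ξ) := by
      rw [← ContinuousLinearMap.comp_apply,
        Submodule.starProjection_comp_starProjection_of_le (familySpan_mono x hJJ')]
    rw [hc]
    exact pow_le_pow_left₀ (norm_nonneg _) (Submodule.norm_starProjection_apply_le _ _) 2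
  · have hins := hmax (insert j J) ((Finset.card_insert_le j J).trans hlt)
    have hc : ((insert j J).card : ℝ) ≤ J.card + 1 := by
      exact_mod_cast Finset.card_insert_le j J
    have hμ : 0 ≤ μ := by
      have hB0 : (0 : ℝ) < B := by exact_mod_cast (Nat.zero_le _).trans_lt hlt
      obtain ⟨J', -, hcard⟩ := Finset.exists_superset_card_eq hJ hB
      exact (pos_of_mul_pos_left ((sq_nonneg _).trans_lt (h J' hcard)) hB0.le).le
    refine (sq_inner_residual_le (familySpan_mono x (Finset.subset_insert j J))
      (Submodule.subset_span ⟨j, by simp, rfl⟩) ξ).trans ?_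
    refine mul_le_mul_of_nonneg_right ?_ (sq_nonneg _)
    nlinarith [mul_le_mul_of_nonneg_left hc hμ]

/-! ### The noise event -/

/-- The logarithmic factor `log (2ep/b)`. -/
def logTerm (p b : ℕ) : ℝ := Real.log (2 * Real.exp 1 * p / b)

/-- The columns of the design as vectors of Euclidean space. -/
def column {n p : ℕ} (X : Matrix (Fin n) (Fin p) ℝ) (j : Fin p) : EuclideanSpace ℝ (Fin n) :=
  WithLp.toLp 2 fun i => X i j

/-- The noise vectors for which some `B` columns of `X` capture at least `8 σ² B log (2ep/B)` of
the squared norm. -/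
def largeNoise {n p : ℕ} (X : Matrix (Fin n) (Fin p) ℝ) (σ : ℝ) (B : ℕ) : Set (Fin n → ℝ) :=
  ⋃ J ∈ Finset.powersetCard B (Finset.univ : Finset (Fin p)),
    {ξ | σ ^ 2 * (8 * (B * logTerm p B)) ≤
      ‖(familySpan (column X) J).starProjection (WithLp.toLp 2 ξ)‖ ^ 2}

lemma measurableSet_largeNoise {n p : ℕ} (X : Matrix (Fin n) (Fin p) ℝ) (σ : ℝ) (B : ℕ) :
    MeasurableSet (largeNoise X σ B) :=
  Finset.measurableSet_biUnion _ fun _ _ => measurableSet_le measurable_const (by fun_prop)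

lemma exp_logTerm {p b : ℕ} (hp : 0 < p) (hb : 0 < b) :
    Real.exp (logTerm p b) = 2 * Real.exp 1 * p / b :=
  Real.exp_log (by positivity)

/-- The number of `B`-subsets of the columns, times the factor `2 ^ B` from Chernoff's bound. -/
lemma choose_mul_two_pow_le {p B : ℕ} (hp : 0 < p) (hB : 0 < B) :
    (p.choose B : ℝ) * 2 ^ B ≤ Real.exp (B * logTerm p B) := by
  rw [Real.exp_nat_mul, exp_logTerm hp hB]
  have h1 : (p.choose B : ℝ) ≤ (p : ℝ) ^ B / B.factorial := Nat.choose_le_pow_div B p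
  have h2 : (B : ℝ) ^ B / B.factorial ≤ Real.exp 1 ^ B := by
    rw [← Real.exp_nat_mul, mul_one]
    exact Real.pow_div_factorial_le_exp _ (Nat.cast_nonneg B) B
  have hB' : (0 : ℝ) < (B : ℝ) ^ B := by positivity
  calc (p.choose B : ℝ) * 2 ^ B ≤ (p : ℝ) ^ B / B.factorial * 2 ^ B := by gcongr
    _ = (2 * p / B) ^ B * ((B : ℝ) ^ B / B.factorial) := by
        rw [div_pow, mul_pow]; field_simp
    _ ≤ (2 * p / B) ^ B * Real.exp 1 ^ B := by gcongr
    _ = (2 * Real.exp 1 * p / B) ^ B := by rw [← mul_pow]; congr 1; ring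

lemma logTerm_eq_add {p a b : ℕ} (hp : 0 < p) (ha : 0 < a) (hb : 0 < b) :
    logTerm p a = logTerm p b + Real.log (b / a) := by
  unfold logTerm
  rw [← Real.log_mul (by positivity) (by positivity)]
  congr 1
  field_simp

lemma mul_logTerm_mono {p a b : ℕ} (ha : 0 < a) (hab : a ≤ b) (hL : 1 ≤ logTerm p b)
    (hp : 0 < p) : a * logTerm p a ≤ b * logTerm p b := by
  have hb := ha.trans_le hab
  have ha' : (0 : ℝ) < a := by exact_mod_cast ha
  have hab' : (a : ℝ) ≤ b := by exact_mod_cast hab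
  have h := Real.log_le_sub_one_of_pos (show (0 : ℝ) < b / a by positivity)
  have h2 : a * Real.log (b / a) ≤ b - a := by
    calc a * Real.log (b / a) ≤ a * (b / a - 1) := by gcongr
      _ = b - a := by field_simp
  rw [logTerm_eq_add hp ha hb]
  nlinarith

lemma largeNoise_prob_le {n p : ℕ} (X : Matrix (Fin n) (Fin p) ℝ) {σ : ℝ} (hσ : 0 < σ) {B : ℕ}
    (hp : 0 < p) (hB : 0 < B) :
    (Measure.pi fun _ : Fin n => gaussianReal 0 (Real.toNNReal (σ ^ 2))).real (largeNoise X σ B) ≤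
      Real.exp (-2 * (B * logTerm p B)) := by
  refine (measureReal_biUnion_finset_le _ _).trans ?_
  have h : ∀ J ∈ Finset.powersetCard B (Finset.univ : Finset (Fin p)),
      (Measure.pi fun _ : Fin n => gaussianReal 0 (Real.toNNReal (σ ^ 2))).real
        {ξ | σ ^ 2 * (8 * (B * logTerm p B)) ≤
          ‖(familySpan (column X) J).starProjection (WithLp.toLp 2 ξ)‖ ^ 2} ≤
      2 ^ B * Real.exp (-(3 / 8) * (8 * (B * logTerm p B))) := fun J hJ =>
    noise_proj_tail hσ _ ((finrank_familySpan_le _ J).trans (Finset.mem_powersetCard.1 hJ).2.le) _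
  refine (Finset.sum_le_sum h).trans ?_
  rw [Finset.sum_const, Finset.card_powersetCard, Finset.card_univ, Fintype.card_fin,
    nsmul_eq_mul, ← mul_assoc]
  refine (mul_le_mul_of_nonneg_right (choose_mul_two_pow_le hp hB) (Real.exp_pos _).le).trans_eq ?_
  rw [← Real.exp_add]
  congr 1
  ring

lemma exp_mul_logTerm_le {p s B : ℕ} (hs : 0 < s) (hsB : s ≤ B) (hp : 0 < p)
    (hL : 1 ≤ logTerm p B) :
    Real.exp (-2 * (B * logTerm p B)) ≤ (2 * s / p : ℝ) ^ (2 * s) := by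
  have h1 := mul_logTerm_mono hs hsB hL hp
  calc Real.exp (-2 * (B * logTerm p B)) ≤ Real.exp (((2 * s : ℕ) : ℝ) * -logTerm p s) := by
        apply Real.exp_le_exp.2
        push_cast
        linarith
    _ = (s / (2 * Real.exp 1 * p) : ℝ) ^ (2 * s) := by
        rw [Real.exp_nat_mul, Real.exp_neg, exp_logTerm hp hs, inv_div]
    _ ≤ (2 * s / p : ℝ) ^ (2 * s) := by
        have he := Real.one_le_exp (zero_le_one (α := ℝ))
        have hp' : (0 : ℝ) < p := by exact_mod_cast hp
        gcongr
        · exact le_mul_of_one_le_left (Nat.cast_nonneg s) one_le_two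
        · nlinarith

lemma empNorm_eq {n : ℕ} (u : Fin n → ℝ) :
    empNorm u = √(1 / n) * ‖(WithLp.toLp 2 u : EuclideanSpace ℝ (Fin n))‖ := by
  rw [EuclideanSpace.norm_eq, empNorm, Real.sqrt_mul (by positivity)]
  simp

/-- Control of the noise off the event: the short part of the noise is paired with `X δ` by the
Cauchy-Schwarz inequality, the nearly orthogonal part with the coefficients `δ`. -/
lemma sum_mul_mulVec_le_of_notMem_largeNoise {n p : ℕ} {X : Matrix (Fin n) (Fin p) ℝ} {σ : ℝ}
    (hσ : 0 < σ) (hn : 0 < n) (hX : ∀ j, empNorm (fun i => X i j) ≤ 1) {B : ℕ}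
    (hBp : B ≤ p) (hL : 0 ≤ logTerm p B) {ξ : Fin n → ℝ} (hξ : ξ ∉ largeNoise X σ B)
    (δ : Fin p → ℝ) :
    (1 / (n : ℝ)) * ∑ i, ξ i * (X *ᵥ δ) i ≤
      σ * √(8 * logTerm p B / n) * (√B * empNorm (X *ᵥ δ) + l1Norm δ) := by
  have hn' : (0 : ℝ) < n := by exact_mod_cast hn
  obtain ⟨P, Q, hPQ, hP, hQ⟩ := exists_short_add_nearly_orthogonal (column X)
    (WithLp.toLp 2 ξ) (μ := σ ^ 2 * (8 * logTerm p B)) (B := B) (by simpa using hBp) fun J hJ => by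
      by_contra hcon
      apply hξ
      refine Set.mem_biUnion (Finset.mem_powersetCard.2 ⟨Finset.subset_univ J, hJ⟩) ?_
      change σ ^ 2 * (8 * (B * logTerm p B)) ≤
        ‖(familySpan (column X) J).starProjection (WithLp.toLp 2 ξ)‖ ^ 2
      linarith [not_lt.1 hcon]
  set S := σ * √(8 * logTerm p B) with hS
  have hSsq : S ^ 2 = σ ^ 2 * (8 * logTerm p B) := by
    rw [hS, mul_pow, Real.sq_sqrt (by positivity)]
  have hS0 : 0 ≤ S := by positivity
  have hnormv : ∀ u : Fin n → ℝ, ‖(WithLp.toLp 2 u : EuclideanSpace ℝ (Fin n))‖ =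
      √n * empNorm u := by
    intro u
    rw [empNorm_eq, ← mul_assoc, ← Real.sqrt_mul hn'.le, mul_one_div_cancel hn'.ne', Real.sqrt_one,
      one_mul]
  have hv : (WithLp.toLp 2 (X *ᵥ δ) : EuclideanSpace ℝ (Fin n)) = ∑ j, δ j • column X j := by
    ext i
    simp [column, Matrix.mulVec, dotProduct, mul_comm]
  have hin : ∑ i, ξ i * (X *ᵥ δ) i =
      inner ℝ (WithLp.toLp 2 ξ : EuclideanSpace ℝ (Fin n)) (WithLp.toLp 2 (X *ᵥ δ)) := by
    simp [PiLp.inner_apply, mul_comm]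
  have hP' : ‖P‖ ≤ S * √B := by
    apply abs_le_of_sq_le_sq' _ (by positivity) |>.2
    rw [mul_pow, hSsq, Real.sq_sqrt (Nat.cast_nonneg B)]
    exact hP
  have hQ' : ∀ j, |inner ℝ Q (column X j)| ≤ S * √n := by
    intro j
    have hc : ‖column X j‖ ≤ √n := by
      rw [column, hnormv]
      exact mul_le_of_le_one_right (Real.sqrt_nonneg _) (hX j)
    apply abs_le_of_sq_le_sq _ (by positivity)
    refine (hQ j).trans ?_
    rw [mul_pow, hSsq]
    gcongr
  have h1 : inner ℝ P (WithLp.toLp 2 (X *ᵥ δ)) ≤ S * √B * (√n * empNorm (X *ᵥ δ)) := by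
    refine (real_inner_le_norm _ _).trans ?_
    rw [hnormv (X *ᵥ δ)]
    exact mul_le_mul_of_nonneg_right hP' (mul_nonneg (Real.sqrt_nonneg _) (Real.sqrt_nonneg _))
  have h2 : inner ℝ Q (WithLp.toLp 2 (X *ᵥ δ)) ≤ S * √n * l1Norm δ := by
    rw [hv, inner_sum, l1Norm, Finset.mul_sum]
    refine Finset.sum_le_sum fun j _ => ?_
    rw [inner_smul_right]
    refine (le_abs_self _).trans ?_
    rw [abs_mul, mul_comm]
    gcongr
    exact hQ' j
  rw [hin, hPQ, inner_add_left, Real.sqrt_div' _ hn'.le]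
  have hsn : √(n : ℝ) ≠ 0 := (Real.sqrt_pos.2 hn').ne'
  have hsn2 : √(n : ℝ) * √n = n := Real.mul_self_sqrt hn'.le
  calc (1 / (n : ℝ)) * (inner ℝ P (WithLp.toLp 2 (X *ᵥ δ)) + inner ℝ Q (WithLp.toLp 2 (X *ᵥ δ)))
      ≤ (1 / (n : ℝ)) * (S * √B * (√n * empNorm (X *ᵥ δ)) + S * √n * l1Norm δ) := by gcongr
    _ = √n * √n / n * (S / √n * (√B * empNorm (X *ᵥ δ) + l1Norm δ)) := by field_simp
    _ = σ * (√(8 * logTerm p B) / √n) * (√B * empNorm (X *ᵥ δ) + l1Norm δ) := by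
        rw [hsn2, div_self hn'.ne', hS]
        ring

/-! ### The Lasso off the noise event -/

lemma empNorm_nonneg {n : ℕ} (u : Fin n → ℝ) : 0 ≤ empNorm u := Real.sqrt_nonneg _

lemma l2Norm_nonneg {p : ℕ} (b : Fin p → ℝ) : 0 ≤ l2Norm b := Real.sqrt_nonneg _

lemma empNorm_sq {n : ℕ} (u : Fin n → ℝ) : empNorm u ^ 2 = (1 / (n : ℝ)) * ∑ i, u i ^ 2 :=
  Real.sq_sqrt (by positivity)

lemma l2Norm_pos {p : ℕ} {b : Fin p → ℝ} (hb : b ≠ 0) : 0 < l2Norm b := by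
  obtain ⟨j, hj⟩ := Function.ne_iff.1 hb
  refine Real.sqrt_pos.2 (Finset.sum_pos' (fun _ _ => sq_nonneg _) ⟨j, Finset.mem_univ j, ?_⟩)
  exact pow_pos (abs_pos.2 hj) 2 |>.trans_eq (sq_abs _)

/-- The basic inequality with the sharp constant: the objective at a minimizer `b` is compared with
the objective at points of the segment from `b` to `β` that are close to `b`. -/
lemma IsLasso.basic_inequality {n p : ℕ} {X : Matrix (Fin n) (Fin p) ℝ} {lam : ℝ}
    {y : Fin n → ℝ} {b : Fin p → ℝ} (h : IsLasso X lam y b) (hlam : 0 ≤ lam) (β : Fin p → ℝ) :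
    empNorm (X *ᵥ (b - β)) ^ 2 ≤
      (1 / (n : ℝ)) * ∑ i, (y - X *ᵥ β) i * (X *ᵥ (b - β)) i + lam * (l1Norm β - l1Norm b) := by
  set ξ := y - X *ᵥ β with hξ
  set v := X *ᵥ (b - β) with hv
  set A := empNorm v ^ 2 with hA
  set I := (1 / (n : ℝ)) * ∑ i, ξ i * v i with hI
  set R := I + lam * (l1Norm β - l1Norm b) with hR
  have hA0 : 0 ≤ A := sq_nonneg _
  have hexp : ∀ r : ℝ, empNorm (r • v - ξ) ^ 2 = r ^ 2 * A - 2 * r * I + empNorm ξ ^ 2 := by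
    intro r
    rw [hA, hI, empNorm_sq, empNorm_sq, empNorm_sq]
    have : ∑ i, (r • v - ξ) i ^ 2 =
        r ^ 2 * ∑ i, v i ^ 2 - 2 * r * ∑ i, ξ i * v i + ∑ i, ξ i ^ 2 := by
      rw [Finset.mul_sum, Finset.mul_sum, ← Finset.sum_sub_distrib, ← Finset.sum_add_distrib]
      refine Finset.sum_congr rfl fun i _ => ?_
      simp only [Pi.sub_apply, Pi.smul_apply, smul_eq_mul]
      ring
    rw [this]
    ring
  have key : ∀ t : ℝ, 0 < t → t ≤ 1 → (2 - t) * A ≤ 2 * R := by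
    intro t ht ht1
    have hmin : empNorm (X *ᵥ b - y) ^ 2 + 2 * lam * l1Norm b ≤
        empNorm (X *ᵥ (b - t • (b - β)) - y) ^ 2 + 2 * lam * l1Norm (b - t • (b - β)) :=
      h (Set.mem_univ _)
    have e1 : X *ᵥ b - y = (1 : ℝ) • v - ξ := by
      rw [hv, hξ, Matrix.mulVec_sub, one_smul]
      abel
    have e2 : X *ᵥ (b - t • (b - β)) - y = (1 - t) • v - ξ := by
      rw [hv, hξ, Matrix.mulVec_sub, Matrix.mulVec_smul, Matrix.mulVec_sub, sub_smul, one_smul]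
      abel
    have e3 : l1Norm (b - t • (b - β)) ≤ (1 - t) * l1Norm b + t * l1Norm β := by
      rw [l1Norm, l1Norm, l1Norm, Finset.mul_sum, Finset.mul_sum, ← Finset.sum_add_distrib]
      refine Finset.sum_le_sum fun j _ => ?_
      have : (b - t • (b - β)) j = (1 - t) * b j + t * β j := by
        simp only [Pi.sub_apply, Pi.smul_apply, smul_eq_mul]
        ring
      rw [this]
      refine (abs_add_le _ _).trans_eq ?_
      rw [abs_mul, abs_mul, abs_of_nonneg (sub_nonneg.2 ht1), abs_of_pos ht]
    rw [e1, e2, hexp, hexp] at hmin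
    have e4 := mul_le_mul_of_nonneg_left e3 hlam
    have : t * ((2 - t) * A) ≤ t * (2 * R) := by
      rw [hR]
      nlinarith
    exact le_of_mul_le_mul_left this ht
  by_contra hcon
  have hgap : 0 < A - R := sub_pos.2 (not_le.1 hcon)
  have ht := key (min 1 ((A - R) / (A + 1))) (by positivity) (min_le_left _ _)
  have h2 : min 1 ((A - R) / (A + 1)) * (A + 1) ≤ A - R := by
    calc _ ≤ (A - R) / (A + 1) * (A + 1) := by gcongr; exact min_le_right _ _
      _ = A - R := by field_simp
  have h3 : 0 < min 1 ((A - R) / (A + 1)) := by positivity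
  nlinarith

lemma sreConst_mul_le {n p : ℕ} (X : Matrix (Fin n) (Fin p) ℝ) {s : ℕ} {c₀ : ℝ}
    {δ : Fin p → ℝ} (hδ : δ ∈ sreCone p s c₀) (h0 : δ ≠ 0) :
    sreConst X s c₀ * l2Norm δ ≤ empNorm (X *ᵥ δ) := by
  have h : sreConst X s c₀ ≤ empNorm (X *ᵥ δ) / l2Norm δ := by
    refine csInf_le ⟨0, ?_⟩ ⟨δ, hδ, h0, rfl⟩
    rintro r ⟨δ', -, -, rfl⟩
    exact div_nonneg (empNorm_nonneg _) (l2Norm_nonneg _)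
  exact (le_div_iff₀ (l2Norm_pos h0)).1 h

lemma sreConst_le_one {n p : ℕ} {X : Matrix (Fin n) (Fin p) ℝ} (hp : 0 < p)
    (hX : ∀ j, empNorm (fun i => X i j) ≤ 1) {s : ℕ} (hs : 1 ≤ s) : sreConst X s 7 ≤ 1 := by
  let j : Fin p := ⟨0, hp⟩
  have h1 : l1Norm (Pi.single j (1 : ℝ)) = 1 := by
    simp [l1Norm, Pi.single_apply, apply_ite abs]
  have h2 : l2Norm (Pi.single j (1 : ℝ)) = 1 := by
    simp [l2Norm, Pi.single_apply, ite_pow]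
  have hc : (Pi.single j (1 : ℝ) : Fin p → ℝ) ∈ sreCone p s 7 := by
    change l1Norm _ ≤ _ * l2Norm _
    rw [h1, h2]
    have : 1 ≤ √(s : ℝ) := Real.one_le_sqrt.2 (by exact_mod_cast hs)
    linarith
  have := sreConst_mul_le X hc (by simp)
  rw [h2, mul_one, Matrix.mulVec_single_one] at this
  exact this.trans (hX j)

lemma sum_abs_le_sqrt_mul_l2Norm {p B : ℕ} (δ : Fin p → ℝ) {S : Finset (Fin p)}
    (hS : S.card ≤ B) : ∑ j ∈ S, |δ j| ≤ √B * l2Norm δ := by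
  rw [l2Norm, ← Real.sqrt_mul (Nat.cast_nonneg B)]
  refine Real.le_sqrt_of_sq_le (sq_sum_le_card_mul_sum_sq.trans ?_)
  simp_rw [sq_abs]
  have : ∑ j ∈ S, δ j ^ 2 ≤ ∑ j, δ j ^ 2 :=
    Finset.sum_le_univ_sum_of_nonneg fun _ => sq_nonneg _
  gcongr

lemma l1Norm_sub_le {p : ℕ} (b β : Fin p → ℝ) {S : Finset (Fin p)} (hS : ∀ j ∉ S, β j = 0) :
    l1Norm β - l1Norm b ≤ ∑ j ∈ S, |(b - β) j| - ∑ j ∈ Sᶜ, |(b - β) j| := by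
  rw [l1Norm, l1Norm, ← Finset.sum_add_sum_compl S, ← Finset.sum_add_sum_compl S (fun j => |b j|)]
  have h1 : ∑ j ∈ S, |β j| ≤ ∑ j ∈ S, |(b - β) j| + ∑ j ∈ S, |b j| := by
    rw [← Finset.sum_add_distrib]
    refine Finset.sum_le_sum fun j _ => ?_
    have := abs_sub (b j) (b j - β j)
    rw [sub_sub_cancel] at this
    simpa [add_comm] using this
  have h2 : ∑ j ∈ Sᶜ, |β j| = 0 :=
    Finset.sum_eq_zero fun j hj => by rw [hS j (Finset.mem_compl.1 hj), abs_zero]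
  have h3 : ∑ j ∈ Sᶜ, |(b - β) j| = ∑ j ∈ Sᶜ, |b j| :=
    Finset.sum_congr rfl fun j hj => by
      rw [Pi.sub_apply, hS j (Finset.mem_compl.1 hj), sub_zero]
  linarith

/-- The deterministic heart of the Lasso bound. If the noise is dominated by a multiple of
`√B ‖Xδ‖_n + |δ|₁` whose factor `μ` is at most half of the tuning parameter, the error either
is at most `μ √B` or lies in the cone on which the restricted eigenvalue is positive. -/
lemma IsLasso.predDist_le_of_noise_le {n p : ℕ} {X : Matrix (Fin n) (Fin p) ℝ} {lam μ : ℝ}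
    {y : Fin n → ℝ} {b β : Fin p → ℝ} (h : IsLasso X lam y b) {B t : ℕ} (hβ : β ∈ sparseBall p B)
    (hμ : 0 ≤ μ) (hlam : 2 * μ ≤ lam) (hlam0 : 0 < lam) (hBt : B ≤ t)
    (hθ : 0 < sreConst X t 7) (hθ1 : sreConst X t 7 ≤ 1)
    (hnoise : (1 / (n : ℝ)) * ∑ i, (y - X *ᵥ β) i * (X *ᵥ (b - β)) i ≤
      μ * (√B * empNorm (X *ᵥ (b - β)) + l1Norm (b - β))) :
    predDist X b β ≤ (lam + 2 * μ) * √B / sreConst X t 7 := by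
  classical
  set θ := sreConst X t 7
  set δ := b - β with hδ
  change empNorm (X *ᵥ δ) ≤ _
  set a := empNorm (X *ᵥ δ)
  have ha : 0 ≤ a := empNorm_nonneg _
  have hB0 : 0 ≤ √(B : ℝ) := Real.sqrt_nonneg _
  let S : Finset (Fin p) := Finset.univ.filter fun j => β j ≠ 0
  have hS : S.card ≤ B := by
    have : {j | β j ≠ 0}.ncard ≤ B := hβ
    rwa [Set.ncard_eq_toFinset_card', Set.toFinset_ofPred] at this
  have hbasic := h.basic_inequality hlam0.le β
  have hl1 := l1Norm_sub_le b β (S := S) fun j hj => by simpa [S] using hj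
  have hsum : l1Norm δ = ∑ j ∈ S, |δ j| + ∑ j ∈ Sᶜ, |δ j| :=
    (Finset.sum_add_sum_compl S _).symm
  have hcs := sum_abs_le_sqrt_mul_l2Norm δ hS
  rw [← hδ] at hbasic hl1
  set u := ∑ j ∈ S, |δ j|
  set w := ∑ j ∈ Sᶜ, |δ j|
  have hu : 0 ≤ u := Finset.sum_nonneg fun _ _ => abs_nonneg _
  have hw : 0 ≤ w := Finset.sum_nonneg fun _ _ => abs_nonneg _
  have hmain : a ^ 2 ≤ μ * √B * a + (lam + μ) * u - (lam - μ) * w := by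
    rw [hsum] at hnoise
    have := mul_le_mul_of_nonneg_left hl1 hlam0.le
    linarith
  rw [le_div_iff₀ hθ]
  rcases le_or_gt ((lam + μ) * u) ((lam - μ) * w) with hcase | hcase
  -- Off the cone the penalty absorbs the `ℓ₁` part of the noise.
  · have h1 : a ≤ μ * √B := by
      rcases ha.eq_or_lt with h0 | h0
      · rw [← h0]; positivity
      · nlinarith
    calc a * θ ≤ a * 1 := by gcongr
      _ ≤ (lam + 2 * μ) * √B := by nlinarith
  · have hw4 : w ≤ 3 * u := by
      by_contra hcon
      nlinarith [not_le.1 hcon, mul_nonneg (sub_nonneg.2 hlam) hu]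
    have hδ0 : δ ≠ 0 := by
      intro h0
      have hu0 : u = 0 := Finset.sum_eq_zero fun j _ => by rw [h0, Pi.zero_apply, abs_zero]
      rw [hu0] at hcase
      nlinarith
    have hcone : δ ∈ sreCone p t 7 := by
      change l1Norm δ ≤ _
      have hBt' : √(B : ℝ) ≤ √t := Real.sqrt_le_sqrt (by exact_mod_cast hBt)
      have := mul_le_mul_of_nonneg_right hBt' (l2Norm_nonneg δ)
      have h4 := mul_nonneg (Real.sqrt_nonneg (t : ℝ)) (l2Norm_nonneg δ)
      rw [hsum]
      linarith
    have hre := sreConst_mul_le X hcone hδ0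
    have hapos : 0 < a := (mul_pos hθ (l2Norm_pos hδ0)).trans_le hre
    have h5 : a ^ 2 ≤ μ * √B * a + (lam + μ) * (√B * l2Norm δ) := by
      have := mul_le_mul_of_nonneg_left hcs (by linarith : 0 ≤ lam + μ)
      have : 0 ≤ (lam - μ) * w := mul_nonneg (by linarith) hw
      linarith
    have h6 : a * (a * θ) ≤ a * ((lam + 2 * μ) * √B) := by
      calc a * (a * θ) = a ^ 2 * θ := by ring
        _ ≤ (μ * √B * a + (lam + μ) * (√B * l2Norm δ)) * θ := by gcongr
        _ = μ * √B * a * θ + (lam + μ) * √B * (θ * l2Norm δ) := by ring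
        _ ≤ μ * √B * a * 1 + (lam + μ) * √B * a := by
            have : 0 ≤ lam + μ := by linarith
            gcongr
        _ = a * ((lam + 2 * μ) * √B) := by ring
    exact le_of_mul_le_mul_left h6 hapos

/-- Off the noise event at level `B`, the Lasso estimators with index between `B / 2` and `B` are
within the threshold at `B` of every `B`-sparse parameter. -/
lemma predDist_le_threshold {n p sStar : ℕ} {X : Matrix (Fin n) (Fin p) ℝ} {σ : ℝ}
    (hn : 0 < n) (hσ : 0 < σ) (hX : ∀ j, empNorm (fun i => X i j) ≤ 1)
    (hθ : 0 < sreConst X (2 * sStar) 7) {b B : ℕ} (hb : 1 ≤ b) (hbB : b ≤ B) (hB2 : B ≤ 2 * b)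
    (hBs : B ≤ 2 * sStar) (hBp : B ≤ p) (hL : 2 ≤ logTerm p B) {β v : Fin p → ℝ}
    (hβ : β ∈ sparseBall p B) {y : Fin n → ℝ} (hv : IsLasso X (tuning n p σ b) y v)
    (hy : y - X *ᵥ β ∉ largeNoise X σ B) :
    predDist X v β ≤ threshold X σ sStar B := by
  have hn' : (0 : ℝ) < n := by exact_mod_cast hn
  have hp : 0 < p := hb.trans (hbB.trans hBp)
  have hB : 0 < B := hb.trans hbB
  set L := logTerm p B with hLdef
  set q := σ * √(L / n) with hq
  have hq0 : 0 < q := by positivity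
  -- The tuning parameter at `b` exceeds the one at `B` by a factor of at most `6 / 5`.
  have hLb : L ≤ logTerm p b ∧ logTerm p b ≤ (6 / 5) ^ 2 * L := by
    have hb' : (0 : ℝ) < b := by exact_mod_cast hb
    rw [logTerm_eq_add hp hb hB]
    have h1 : (1 : ℝ) ≤ B / b := by
      rw [one_le_div hb']; exact_mod_cast hbB
    have h2 : (B : ℝ) / b ≤ 2 := by
      rw [div_le_iff₀ hb']; exact_mod_cast hB2
    have h3 := Real.log_nonneg h1
    have h4 := Real.log_le_log (by positivity) h2
    have h5 := Real.log_two_lt_d9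
    constructor <;> linarith
  have hs2 : √(2 : ℝ) ≤ 3 / 2 := Real.sqrt_le_iff.2 (by norm_num)
  have hlow : 2 * (4 + √2) * q ≤ tuning n p σ b := by
    have : √(L / n) ≤ √(logTerm p b / n) := by gcongr; exact hLb.1
    change _ ≤ 2 * (4 + √2) * σ * √(logTerm p b / n)
    rw [hq, ← mul_assoc]
    gcongr
  have hup : tuning n p σ b ≤ 6 / 5 * (2 * (4 + √2) * q) := by
    have : √(logTerm p b / n) ≤ 6 / 5 * √(L / n) := by
      rw [← Real.sqrt_sq (show (0 : ℝ) ≤ 6 / 5 by norm_num), ← Real.sqrt_mul (by positivity),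
        ← mul_div_assoc]
      gcongr
      exact hLb.2
    change 2 * (4 + √2) * σ * √(logTerm p b / n) ≤ _
    calc _ ≤ 2 * (4 + √2) * σ * (6 / 5 * √(L / n)) := by gcongr
      _ = _ := by rw [hq]; ring
  have h8 : σ * √(8 * L / n) = 2 * √2 * q := by
    rw [show 8 * L / n = 2 ^ 2 * (2 * (L / n)) by ring, Real.sqrt_mul (by positivity),
      Real.sqrt_mul (by positivity), Real.sqrt_sq (by positivity), hq]
    ring
  have hnoise := sum_mul_mulVec_le_of_notMem_largeNoise hσ hn hX hBp (by linarith) hy (v - β)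
  rw [← hLdef, h8] at hnoise
  have hs1 : 1 ≤ 2 * sStar := hB.trans_le hBs
  refine (hv.predDist_le_of_noise_le hβ (by positivity) (by nlinarith)
    (hlow.trans_lt' (by positivity)) hBs hθ
    (sreConst_le_one hp hX hs1) hnoise).trans ?_
  have hthr : threshold X σ sStar B =
      7 / 4 * (2 * (4 + √2) * q) * √B / sreConst X (2 * sStar) 7 := by
    change constC₀ X sStar * σ * √(B * L / n) = _
    rw [mul_div_assoc, Real.sqrt_mul (Nat.cast_nonneg B), constC₀, hq]
    field_simp
    ring
  rw [hthr]
  gcongr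
  nlinarith

/-! ### The selection rule off the noise events -/

lemma predDist_triangle {n p : ℕ} (X : Matrix (Fin n) (Fin p) ℝ) (u v w : Fin p → ℝ) :
    predDist X u w ≤ predDist X u v + predDist X v w := by
  have h : X *ᵥ (u - w) = X *ᵥ (u - v) + X *ᵥ (v - w) := by
    rw [← Matrix.mulVec_add, sub_add_sub_cancel]
  rw [predDist, predDist, predDist, h, empNorm_eq, empNorm_eq, empNorm_eq, WithLp.toLp_add,
    ← mul_add]
  exact mul_le_mul_of_nonneg_left (norm_add_le _ _) (Real.sqrt_nonneg _)

lemma predDist_comm {n p : ℕ} (X : Matrix (Fin n) (Fin p) ℝ) (u v : Fin p → ℝ) :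
    predDist X u v = predDist X v u := by
  rw [predDist, predDist, ← neg_sub v u, Matrix.mulVec_neg, empNorm_eq, empNorm_eq, WithLp.toLp_neg,
    norm_neg]

lemma predDist_self {n p : ℕ} (X : Matrix (Fin n) (Fin p) ℝ) (u : Fin p → ℝ) :
    predDist X u u = 0 := by
  simp [predDist, empNorm]

lemma gridMax_eq {sStar : ℕ} (h : 2 ≤ sStar) : gridMax sStar = Nat.log 2 sStar + 1 := by
  refine IsGreatest.csSup_eq ⟨⟨by omega, ?_⟩, ?_⟩
  · exact Nat.pow_log_le_self 2 (by omega)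
  · rintro m ⟨h1, h2⟩
    have := (Nat.le_log_iff_pow_le (b := 2) one_lt_two (by omega : sStar ≠ 0)).2 h2
    omega

lemma two_le_gridMax {sStar : ℕ} (h : 2 ≤ sStar) : 2 ≤ gridMax sStar := by
  have := Nat.log_pos one_lt_two h
  rw [gridMax_eq h]
  omega

lemma grid_le_iff {sStar k : ℕ} (h : 2 ≤ sStar) (hk : 1 ≤ k) :
    grid k ≤ sStar ↔ k ≤ gridMax sStar := by
  rw [gridMax_eq h, grid, ← Nat.le_log_iff_pow_le one_lt_two (by omega)]
  omega

section Selection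

variable {n p : ℕ} {X : Matrix (Fin n) (Fin p) ℝ} {σ : ℝ} {sStar : ℕ} {est : ℕ → Fin p → ℝ}

lemma mHat_mem_Icc (h : 2 ≤ sStar) : 2 ≤ mHat X σ sStar est ∧ mHat X σ sStar est ≤ gridMax sStar := by
  unfold mHat
  split_ifs with hne
  · exact ⟨(Nat.sInf_mem hne).1, (Nat.sInf_mem hne).2.1⟩
  · exact ⟨two_le_gridMax h, le_rfl⟩

lemma predDist_le_of_mHat_lt {k : ℕ} (hk : mHat X σ sStar est < k) (hkM : k ≤ gridMax sStar) :
    predDist X (est (grid k)) (est (grid (k - 1))) ≤ 2 * threshold X σ sStar (grid k) := by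
  unfold mHat at hk
  split_ifs at hk with hne
  · exact (Nat.sInf_mem hne).2.2 k hk.le hkM
  · omega

lemma notMem_admissible_of_lt_mHat {m : ℕ} (hm : m < mHat X σ sStar est) :
    m ∉ admissible X σ sStar est := by
  unfold mHat at hm
  split_ifs at hm with hne
  · exact Nat.notMem_of_lt_sInf hm
  · exact fun h => hne ⟨m, h⟩

/-- On the good event, every test at a grid point above `s` is passed, by the triangle inequality
through `β`. -/
lemma sHat_le {β : Fin p → ℝ} {s : ℕ} (h2 : 2 ≤ sStar) (hs : 1 ≤ s)
    (hgood : ∀ j b, s < 2 ^ j → 2 ^ j ≤ 2 * sStar → b ≤ 2 ^ j → 2 ^ j ≤ 2 * b →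
      predDist X (est b) β ≤ threshold X σ sStar (2 ^ j)) :
    sHat X σ sStar est ≤ s := by
  by_contra! hcon
  have hm := mHat_mem_Icc (X := X) (σ := σ) (est := est) h2
  rw [sHat, grid] at hcon
  have hm2 : mHat X σ sStar est - 1 - 1 ≠ 0 := fun h0 => by
    rw [h0, pow_zero] at hcon
    omega
  have hnot := notMem_admissible_of_lt_mHat (X := X) (σ := σ) (sStar := sStar) (est := est)
    (m := mHat X σ sStar est - 1) (by omega)
  -- A threshold is exceeded at some grid point `2 ^ (k - 1) > s`, against the good event there.
  have : ∃ k, mHat X σ sStar est - 1 ≤ k ∧ k ≤ gridMax sStar ∧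
      2 * threshold X σ sStar (grid k) < predDist X (est (grid k)) (est (grid (k - 1))) := by
    by_contra! hall
    exact hnot ⟨by omega, by omega, hall⟩
  obtain ⟨k, hk1, hkM, hk⟩ := this
  have hks : s < 2 ^ (k - 1) := hcon.trans_le (Nat.pow_le_pow_right two_pos (by omega))
  have hle := (grid_le_iff h2 (by omega)).2 hkM
  have hpow : 2 ^ (k - 1) = 2 * 2 ^ (k - 1 - 1) := by
    rw [← pow_succ']
    congr 1
    omega
  have ha := hgood (k - 1) (grid k) hks (by rw [grid] at hle; omega) le_rfl (by rw [grid]; omega)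
  have hb := hgood (k - 1) (grid (k - 1)) hks (by rw [grid] at hle; omega)
    (by rw [grid]; omega) (by rw [grid]; omega)
  have htri := predDist_triangle X (est (grid k)) β (est (grid (k - 1)))
  rw [predDist_comm X β] at htri
  simp only [grid] at ha hb hk htri
  linarith

lemma threshold_le_mul {a b : ℕ} {c : ℝ} (hC : 0 ≤ constC₀ X sStar * σ) (hc : 0 ≤ c)
    (h : a * logTerm p a ≤ c ^ 2 * (b * logTerm p b)) :
    threshold X σ sStar a ≤ c * threshold X σ sStar b := by
  change constC₀ X sStar * σ * √(a * logTerm p a / n) ≤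
    c * (constC₀ X sStar * σ * √(b * logTerm p b / n))
  rw [mul_left_comm]
  refine mul_le_mul_of_nonneg_left ?_ hC
  calc √(a * logTerm p a / n) ≤ √(c ^ 2 * (b * logTerm p b / n)) := by
        rw [← mul_div_assoc]
        gcongr
    _ = c * √(b * logTerm p b / n) := by rw [Real.sqrt_mul (sq_nonneg c), Real.sqrt_sq hc]

/-- On the good event, the selected estimator is within a multiple of the threshold at `s`: `43 / 2`
is `20` for the chain along the grid and `3 / 2` for the estimator that ends it. -/
lemma predDist_betaTilde_le {β : Fin p → ℝ} {s : ℕ} (hC : 0 ≤ constC₀ X sStar * σ) (hp : 0 < p)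
    (h2 : 2 ≤ sStar) (hs : 1 ≤ s) (hss : s ≤ sStar)
    (hL : ∀ b, 1 ≤ b → b ≤ 2 * sStar → 2 ≤ logTerm p b)
    (hgood : ∀ j b, s < 2 ^ j → 2 ^ j ≤ 2 * sStar → b ≤ 2 ^ j → 2 ^ j ≤ 2 * b →
      predDist X (est b) β ≤ threshold X σ sStar (2 ^ j)) :
    predDist X (betaTilde X σ sStar est) β ≤ 43 / 2 * threshold X σ sStar s := by
  have hsHat := sHat_le h2 hs hgood
  obtain ⟨hm2, hmM⟩ := mHat_mem_Icc (X := X) (σ := σ) (est := est) h2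
  set m := mHat X σ sStar est with hm
  have hgm : 2 * sHat X σ sStar est = grid m := by
    rw [sHat, grid, grid, ← pow_succ', ← hm]
    congr 1
    omega
  have hW0 : ∀ b, 0 ≤ threshold X σ sStar b := fun b => mul_nonneg hC (Real.sqrt_nonneg _)
  -- Doubling the index costs a factor of at most `√2 ≤ 3 / 2` in the threshold.
  have hupper : ∀ B, 1 ≤ B → B ≤ 2 * s →
      threshold X σ sStar B ≤ 3 / 2 * threshold X σ sStar s := by
    intro B hB hBs
    refine threshold_le_mul hC (by norm_num) ?_
    have h1 := mul_logTerm_mono hB hBs (by linarith [hL (2 * s) (by omega) (by omega)]) hp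
    have h3 := hL s hs (by omega)
    have h4 := logTerm_eq_add hp hs (b := 2 * s) (by omega)
    have h5 : 0 ≤ Real.log (((2 * s : ℕ) : ℝ) / s) := by
      apply Real.log_nonneg
      rw [one_le_div (by positivity)]
      push_cast
      linarith [(Nat.cast_nonneg s : (0 : ℝ) ≤ s)]
    have h6 : (s : ℝ) * logTerm p (2 * s) ≤ s * logTerm p s := by gcongr; linarith
    push_cast at h1
    nlinarith [mul_nonneg (Nat.cast_nonneg s : (0 : ℝ) ≤ s) (by linarith : 0 ≤ logTerm p s)]
  have hchain : ∀ k, m ≤ k → k ≤ gridMax sStar →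
      predDist X (est (grid m)) (est (grid k)) ≤ 20 * threshold X σ sStar (grid k) := by
    intro k hk
    induction k, hk using Nat.le_induction with
    | base =>
      intro _
      rw [predDist_self]
      linarith [hW0 (grid m)]
    | succ k hk ih =>
      intro hkM
      have h1 := ih (by omega)
      have h3 := predDist_le_of_mHat_lt (X := X) (σ := σ) (est := est) (k := k + 1)
        (by omega) hkM
      rw [Nat.add_sub_cancel, predDist_comm] at h3
      have h4 := predDist_triangle X (est (grid m)) (est (grid k)) (est (grid (k + 1)))
      have hgk : grid (k + 1) = 2 * grid k := by
        rw [grid, grid, ← pow_succ']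
        congr 1
        omega
      have hgpos : 1 ≤ grid k := Nat.one_le_two_pow
      have hle := (grid_le_iff h2 (by omega)).2 hkM
      -- The thresholds grow geometrically along the grid, so the last one dominates their sum.
      have h5 : threshold X σ sStar (grid k) ≤ 9 / 10 * threshold X σ sStar (grid (k + 1)) := by
        refine threshold_le_mul hC (by norm_num) ?_
        rw [logTerm_eq_add hp hgpos (b := grid (k + 1)) (by omega)]
        have hdiv : ((grid (k + 1) : ℕ) : ℝ) / grid k = 2 := by
          rw [hgk]
          push_cast
          field_simp
        rw [hdiv]
        have h6 := hL (grid (k + 1)) (by omega) (by omega)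
        have h7 := Real.log_two_lt_d9
        have h8 : (0 : ℝ) < grid k := by exact_mod_cast hgpos
        have h9 : ((grid (k + 1) : ℕ) : ℝ) = 2 * grid k := by exact_mod_cast hgk
        rw [h9]
        nlinarith
      linarith
  change predDist X (est (2 * sHat X σ sStar est)) β ≤ _
  have hgs : grid m ≤ 2 * s := by omega
  rw [hgm]
  rcases lt_or_ge s (grid m) with hcase | hcase
  · have h1 := hgood (m - 1) (grid m) hcase (by rw [grid] at hgs; omega) le_rfl
      (by rw [grid]; omega)
    have h3 := hupper (2 ^ (m - 1)) Nat.one_le_two_pow hgs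
    linarith [hW0 s]
  · set r := Nat.log 2 s
    have hr : 2 ^ r ≤ s := Nat.pow_log_le_self 2 (by omega)
    have hr' : s < 2 ^ (r + 1) := Nat.lt_pow_succ_log_self one_lt_two s
    have hgr : grid (r + 1) = 2 ^ r := rfl
    have hmr : m ≤ r + 1 := by
      have := (Nat.le_log_iff_pow_le (b := 2) one_lt_two (by omega : s ≠ 0)).2 hcase
      omega
    have hrM := (grid_le_iff h2 (by omega : 1 ≤ r + 1)).1 (by omega)
    have h1 := hchain (r + 1) hmr hrM
    have hpow : 2 ^ (r + 1) = 2 * 2 ^ r := pow_succ' 2 r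
    have h3 := hgood (r + 1) (2 ^ r) hr' (by omega) (by omega) hpow.le
    have h4 := hupper (2 ^ (r + 1)) Nat.one_le_two_pow (by omega)
    have h5 := predDist_triangle X (est (grid m)) (est (2 ^ r)) β
    have h6 : threshold X σ sStar (2 ^ r) ≤ 1 * threshold X σ sStar s := by
      refine threshold_le_mul hC zero_le_one ?_
      rw [one_pow, one_mul]
      exact mul_logTerm_mono Nat.one_le_two_pow hr (by linarith [hL s hs (by omega)]) hp
    rw [hgr] at h1
    linarith

end Selection

/-! ### Probability of the noise events -/

lemma two_le_logTerm {p sStar b : ℕ} (hsp : (sStar : ℝ) ≤ p / (2 * Real.exp 1)) (hb : 1 ≤ b)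
    (hbs : b ≤ 2 * sStar) : 2 ≤ logTerm p b := by
  have hb' : (0 : ℝ) < b := by exact_mod_cast hb
  have hbs' : (b : ℝ) ≤ 2 * sStar := by exact_mod_cast hbs
  have he := Real.exp_pos 1
  rw [le_div_iff₀ (by positivity)] at hsp
  have h1 : Real.exp 2 * b ≤ 2 * Real.exp 1 * p := by
    rw [show (2 : ℝ) = 1 + 1 by norm_num, Real.exp_add]
    nlinarith
  have h2 : Real.exp 2 ≤ 2 * Real.exp 1 * p / b := (le_div_iff₀ hb').2 h1
  exact (Real.le_log_iff_exp_le ((Real.exp_pos 2).trans_le h2)).2 h2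

/-- The observations whose noise is large at some dyadic level in `(s, 2 s_*]`. -/
def badObs {n p : ℕ} (X : Matrix (Fin n) (Fin p) ℝ) (σ : ℝ) (sStar s : ℕ) (β : Fin p → ℝ) :
    Set (Fin n → ℝ) :=
  ⋃ j ∈ (Finset.Icc 1 (Nat.log 2 (2 * sStar))).filter (fun j => s < 2 ^ j),
    {y | y - X *ᵥ β ∈ largeNoise X σ (2 ^ j)}

lemma measurableSet_badObs {n p : ℕ} (X : Matrix (Fin n) (Fin p) ℝ) (σ : ℝ) (sStar s : ℕ)
    (β : Fin p → ℝ) : MeasurableSet (badObs X σ sStar s β) :=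
  Finset.measurableSet_biUnion _ fun _ _ =>
    (by fun_prop : Measurable fun y : Fin n → ℝ => y - X *ᵥ β) (measurableSet_largeNoise X σ _)

instance {n p : ℕ} (X : Matrix (Fin n) (Fin p) ℝ) (σ : ℝ) (β : Fin p → ℝ) :
    IsProbabilityMeasure (modelLaw X σ β) :=
  Measure.isProbabilityMeasure_map (by fun_prop)

lemma modelLaw_badObs_le {n p sStar s : ℕ} {X : Matrix (Fin n) (Fin p) ℝ} {σ : ℝ} (hσ : 0 < σ)
    (hp : 2 * sStar ≤ p) (hs : 1 ≤ s) (hss : s ≤ sStar)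
    (hL : ∀ b, 1 ≤ b → b ≤ 2 * sStar → 2 ≤ logTerm p b) (β : Fin p → ℝ) :
    (modelLaw X σ β).real (badObs X σ sStar s β) ≤
      2 * (Real.logb 2 p) ^ 2 * (2 * s / p : ℝ) ^ (2 * s) := by
  set F := (Finset.Icc 1 (Nat.log 2 (2 * sStar))).filter (fun j => s < 2 ^ j)
  have hterm : ∀ j ∈ F, (modelLaw X σ β).real {y | y - X *ᵥ β ∈ largeNoise X σ (2 ^ j)} ≤
      (2 * s / p : ℝ) ^ (2 * s) := by
    intro j hj
    obtain ⟨hj1, hj2⟩ := Finset.mem_filter.1 hj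
    have hj3 := (Nat.le_log_iff_pow_le (b := 2) one_lt_two (by omega : 2 * sStar ≠ 0)).1
      (Finset.mem_Icc.1 hj1).2
    have hmeas : MeasurableSet {y | y - X *ᵥ β ∈ largeNoise X σ (2 ^ j)} :=
      (by fun_prop : Measurable fun y : Fin n → ℝ => y - X *ᵥ β) (measurableSet_largeNoise X σ _)
    rw [modelLaw, map_measureReal_apply (by fun_prop) hmeas]
    have hpre : (fun ξ => X *ᵥ β + ξ) ⁻¹' {y | y - X *ᵥ β ∈ largeNoise X σ (2 ^ j)} =
        largeNoise X σ (2 ^ j) := by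
      ext ξ
      change X *ᵥ β + ξ - X *ᵥ β ∈ largeNoise X σ (2 ^ j) ↔ _
      rw [add_sub_cancel_left]
    rw [hpre]
    exact (largeNoise_prob_le X hσ (by omega) (by omega)).trans
      (exp_mul_logTerm_le hs hj2.le (by omega)
        (by linarith [hL (2 ^ j) Nat.one_le_two_pow hj3]))
  have hcard : (F.card : ℝ) ≤ 2 * (Real.logb 2 p) ^ 2 := by
    have h1 : F.card ≤ Nat.log 2 p := by
      refine (Finset.card_filter_le _ _).trans ?_
      rw [Nat.card_Icc, Nat.add_sub_cancel]
      exact Nat.log_mono_right hp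
    have h2 : (F.card : ℝ) ≤ Real.logb 2 p :=
      (Nat.cast_le.2 h1).trans (Real.natLog_le_logb p 2)
    have h3 : 1 ≤ Real.logb 2 p := by
      rw [Real.le_logb_iff_rpow_le one_lt_two (by exact_mod_cast (by omega : 0 < p)),
        Real.rpow_one]
      exact_mod_cast (by omega : 2 ≤ p)
    nlinarith
  refine (measureReal_biUnion_finset_le _ _).trans ((Finset.sum_le_sum hterm).trans ?_)
  rw [Finset.sum_const, nsmul_eq_mul]
  gcongr

end LassoLepski

end

theorem mainTheorem6 :
    ∃ C₁ : ℝ, 0 < C₁ ∧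
      ∀ (n p sStar : ℕ) (X : Matrix (Fin n) (Fin p) ℝ) (σ : ℝ)
        (betaHat : ℕ → (Fin n → ℝ) → (Fin p → ℝ)),
        0 < n → 0 < σ →
        (∀ j, LassoLepski.empNorm (fun i => X i j) ≤ 1) →
        2 ≤ sStar → (sStar : ℝ) ≤ p / (2 * Real.exp 1) →
        0 < LassoLepski.sreConst X (2 * sStar) 7 →
        (∀ k, 1 ≤ k → k ≤ 2 * sStar → ∀ y,
          LassoLepski.IsLasso X (LassoLepski.tuning n p σ k) y (betaHat k y)) →
        ∀ s : ℕ, 1 ≤ s → s ≤ sStar → ∀ β ∈ LassoLepski.sparseBall p s,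
          (LassoLepski.modelLaw X σ β).real
              {y | C₁ * LassoLepski.constC₀ X sStar * σ *
                    Real.sqrt (s * Real.log (2 * Real.exp 1 * p / s) / n) ≤
                  LassoLepski.empNorm
                    (X *ᵥ (LassoLepski.betaTilde X σ sStar (fun k => betaHat k y) - β))} ≤
            (2 * (Real.logb 2 p) ^ 2 + 1) * (2 * s / p : ℝ) ^ (2 * s) ∧
          1 - 2 * (Real.logb 2 p) ^ 2 * (2 * s / p : ℝ) ^ (2 * s) ≤
            (LassoLepski.modelLaw X σ β).real
              {y | LassoLepski.sHat X σ sStar (fun k => betaHat k y) ≤ s} := by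
  open LassoLepski in
  -- Any constant above `43 / 2` turns the bound on the good event into a strict inequality.
  refine ⟨22, by norm_num, ?_⟩
  intro n p sStar X σ betaHat hn hσ hX h2 hsp hθ hlasso s hs hss β hβ
  have hL : ∀ b, 1 ≤ b → b ≤ 2 * sStar → 2 ≤ logTerm p b := fun b => two_le_logTerm hsp
  have hp : 2 * sStar ≤ p := by
    have he := Real.one_le_exp (zero_le_one (α := ℝ))
    rw [le_div_iff₀ (by positivity)] at hsp
    have : (2 * sStar : ℝ) ≤ p := by
      nlinarith [(Nat.cast_nonneg sStar : (0 : ℝ) ≤ sStar)]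
    exact_mod_cast this
  have hC : 0 < constC₀ X sStar * σ := by
    unfold constC₀
    positivity
  have hgood : ∀ y ∉ badObs X σ sStar s β, ∀ j b, s < 2 ^ j → 2 ^ j ≤ 2 * sStar → b ≤ 2 ^ j →
      2 ^ j ≤ 2 * b → predDist X (betaHat b y) β ≤ threshold X σ sStar (2 ^ j) := by
    intro y hy j b hj hj2 hb hb2
    have hjpos : 1 ≤ j := Nat.one_le_iff_ne_zero.2 fun h0 => by
      rw [h0, pow_zero] at hj
      omega
    refine predDist_le_threshold hn hσ hX hθ (by omega) hb hb2 hj2 (by omega)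
      (hL _ Nat.one_le_two_pow hj2) (le_trans (show _ ≤ s from hβ) hj.le)
      (hlasso b (by omega) (by omega) y) fun hmem => hy ?_
    exact Set.mem_biUnion (Finset.mem_filter.2 ⟨Finset.mem_Icc.2 ⟨hjpos,
      (Nat.le_log_iff_pow_le one_lt_two (by omega)).2 hj2⟩, hj⟩) hmem
  have hbad := modelLaw_badObs_le (X := X) hσ hp hs hss hL β
  have hpow : (0 : ℝ) ≤ (2 * s / p : ℝ) ^ (2 * s) := by positivity
  constructor
  · refine (measureReal_mono (h₂ := measure_ne_top _ _) ?_).trans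
      (hbad.trans (by linarith))
    intro y hy
    by_contra hcon
    have h1 : 22 * constC₀ X sStar * σ * √(s * logTerm p s / n) ≤
        predDist X (betaTilde X σ sStar fun k => betaHat k y) β := hy
    have h3 := predDist_betaTilde_le hC.le (by omega) h2 hs hss hL (hgood y hcon)
    have h4 : threshold X σ sStar s = constC₀ X sStar * σ * √(s * logTerm p s / n) := rfl
    have h5 : 0 < √(s * logTerm p s / n) := by
      have := hL s hs (by omega)
      have hs' : (0 : ℝ) < s := by exact_mod_cast hs
      have hn' : (0 : ℝ) < n := by exact_mod_cast hn
      positivity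
    rw [h4] at h3
    nlinarith [mul_pos hC h5]
  · have hcompl := probReal_compl_eq_one_sub (μ := modelLaw X σ β)
      (measurableSet_badObs X σ sStar s β)
    refine le_trans (by linarith) (hcompl.symm.le.trans (measureReal_mono
      (h₂ := measure_ne_top _ _) ?_))
    exact fun y hy => sHat_le h2 hs (hgood y hy)
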